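/- Conventions. For a valued field $F$ with valuation $|\cdot|$ (written multiplicatively, with $|0|=0$) and $\lambda\le 1$ in its value group, $\mathrm{RV}_{\lambda,F}:=(F^\times/B_{<\lambda}(1))\cup\{0\}$, where $B_{<\lambda}(1)=\{x : |x-1|<\lambda\}$, and $\mathrm{rv}_\lambda\colon F\to \mathrm{RV}_{\lambda,F}$ is the canonical map; the index $\lambda$ is omitted if $\lambda=1$. A set $X\subseteq F$ is $\lambda$-prepared by a finite set $C\subseteq F$ if whether $x$ lies in $X$ depends only on the tuple $(\mathrm{rv}_\lambda(x-c))_{c\in C}$. Let $T$ be the theory of a valued field of characteristic $0$ in a language expanding the valued field language. For $T$ of equi-characteristic $0$, $T$ is $0$-h-minimal if for every model $N$ of $T$ and every $A\subseteq N$, every $(A\cup \mathrm{RV}_N)$-definable set $X\subseteq N$ is $1$-prepared by some finite $A$-definable set $C\subseteq N$. The theory $T$ is $0$-h$^{\mathrm{mix}}$-minimal if for every model $N$ of $T$, every $A\subseteq N$ and every integer $m'\ge 1$, every $(A\cup \mathrm{RV}_{|m'|,N})$-definable set $X\subseteq N$ is $|m|$-prepared, for some integer $m\ge 1$, by some finite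 $A$-definable set $C\subseteq N$. A valued field of finite residue characteristic $p$ is finitely ramified if only finitely many elements of its value group lie between $|p|$ and $1$. Proposition. Let $K$ be a valued field of characteristic $0$, considered as a structure in a language expanding the valued field language, such that either (i) $K$ has residue characteristic $0$ and $\mathrm{Th}(K)$ is $0$-h-minimal, or (ii) $K$ has finite residue characteristic, is finitely ramified, and $\mathrm{Th}(K)$ is $0$-h$^{\mathrm{mix}}$-minimal. Let $M\succ K$ be an elementary extension and let $\alpha\in M$ be a pseudo-Cauchy limit over $K$, i.e. for every $a\in K$ there is $a'\in K$ with $|\alpha-a'|<|\alpha-a|$. Let $L:=\mathrm{acl}_{\mathrm{VF}}(K,\alpha)$ be the field-sort part of the model-theoretic algebraic closure of $K\cup\{\alpha\}$ in $M$, i.e. the union of all finite $(K\cup\{\alpha\})$-definable subsets of $M$. Then $L$ is (the universe of) a substructure of $M$ which is an elementary extension of $K$, and $\mathrm{RV}_L=\mathrm{RV}_K$ (as subsets of $\mathrm{RV}_M$); that is, $L$ is an immediate elementary extension of $K$: it has the same value group and the same residue field as $K$. Moreover $L=\mathrm{dcl}_{\mathrm{VF}}(K,\alpha)$, i.e. for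 every $\beta\in L$ the set $\{\beta\}$ is definable in $M$ with parameters from $K\cup\{\alpha\}$. -/

import Mathlib

open scoped FirstOrder

universe u v w

namespace HMin

/-- The single relation symbol, of arity one, naming the valuation ring. -/
inductive ValRel : ℕ → Type
  | integer : ValRel 1

/-- The language of valued fields: the language of rings together with a unary predicate for the
valuation ring. -/
def valuedField : FirstOrder.Language.{0, 0} :=
  FirstOrder.Language.ring.sum ⟨fun _ => Empty, ValRel⟩

/-- The structure on a field `N` with valuation ring `O` in the language of valued fields. -/
@[reducible] noncomputable def valuedFieldStructure {N : Type w} [Field N] (O : ValuationSubring N) :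
    valuedField.Structure N :=
  letI : FirstOrder.Language.ring.Structure N := (FirstOrder.Ring.compatibleRingOfRing N).toStructure
  letI : FirstOrder.Language.Structure ⟨fun _ => Empty, ValRel⟩ N :=
    { funMap := fun s _ => s.elim
      RelMap := fun r x => match r, x with
        | ValRel.integer, x => x 0 ∈ O }
  FirstOrder.Language.sumStructure FirstOrder.Language.ring ⟨fun _ => Empty, ValRel⟩ N

/-- The `L`-structure on `N` expands the valued field `(N, O)`, where `φ` exhibits `L` as a
language expanding the language of valued fields. -/
def IsExpansion {L : FirstOrder.Language.{u, v}} (φ : valuedField →ᴸ L) {N : Type w} [Field N]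
    (O : ValuationSubring N) [L.Structure N] : Prop :=
  letI := valuedFieldStructure O
  φ.IsExpansionOn N

section RV

variable {N : Type w} [Field N] (O : ValuationSubring N)

/-- Elements `lam ≤ 1` of the value group (so `lam ≠ 0`). -/
def Radius : Type w := {lam : O.ValueGroup // lam ≠ 0 ∧ lam ≤ 1}

/-- The radius `1`. -/
noncomputable def Radius.one : Radius O := ⟨1, one_ne_zero, le_rfl⟩

theorem valuation_natCast_le_one (m : ℕ) : O.valuation (m : N) ≤ 1 :=
  (O.valuation_le_one_iff _).2 (natCast_mem O m)

/-- The radius `|m|`, for a positive integer `m`. -/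
noncomputable def Radius.ofNat [CharZero N] (m : ℕ+) : Radius O :=
  ⟨O.valuation ((m : ℕ) : N),
    (Valuation.ne_zero_iff _).2 (Nat.cast_ne_zero.2 m.ne_zero),
    valuation_natCast_le_one O m⟩

variable {O}

theorem valuation_eq_one_of_sub_one_lt {lam : Radius O} {x : N}
    (hx : O.valuation (x - 1) < lam.1) : O.valuation x = 1 := by
  have h : O.valuation (x - 1) < O.valuation 1 := by
    rw [map_one]; exact hx.trans_le lam.2.2
  simpa using Valuation.map_eq_of_sub_lt _ h

/-- The open ball of radius `lam` around `1`, as a subgroup of the multiplicative group. -/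
def oneBall (lam : Radius O) : Subgroup Nˣ where
  carrier := {x | O.valuation ((x : N) - 1) < lam.1}
  one_mem' := by simpa using zero_lt_iff.2 lam.2.1
  mul_mem' := by
    intro a b ha hb
    simp only [Set.mem_ofPred_eq, Units.val_mul] at ha hb ⊢
    have e : (a : N) * b - 1 = a * (b - 1) + (a - 1) := by ring
    rw [e]
    refine Valuation.map_add_lt _ ?_ ha
    rwa [map_mul, valuation_eq_one_of_sub_one_lt ha, one_mul]
  inv_mem' := by
    intro a ha
    simp only [Set.mem_ofPred_eq] at ha ⊢
    have e : ((a⁻¹ : Nˣ) : N) - 1 = -((a : N)⁻¹ * (a - 1)) := by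
      rw [Units.val_inv_eq_inv_val, mul_sub, inv_mul_cancel₀ a.ne_zero, mul_one, neg_sub]
    rw [e, Valuation.map_neg, map_mul, map_inv₀, valuation_eq_one_of_sub_one_lt ha, inv_one,
      one_mul]
    exact ha

/-- The leading term structure `RV_lam = (Nˣ / B_{<lam}(1)) ∪ {0}`. -/
abbrev RV (lam : Radius O) : Type w := WithZero (Nˣ ⧸ oneBall lam)

open Classical in
/-- The canonical map `rv_lam : N → RV_lam`. -/
noncomputable def rv (lam : Radius O) (x : N) : RV lam :=
  if h : x = 0 then 0 else ((Units.mk0 x h : Nˣ ⧸ oneBall lam) : WithZero (Nˣ ⧸ oneBall lam))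

/-- Whether `x` lies in `X` depends only on the tuple `(rv_lam (x - c))_{c ∈ C}`. -/
def Prepares (lam : Radius O) (C X : Set N) : Prop :=
  ∀ x x' : N, (∀ c ∈ C, rv lam (x - c) = rv lam (x' - c)) → (x ∈ X ↔ x' ∈ X)

/-- `X ⊆ N` is `(A ∪ RV_lam)`-definable: it is the fibre, over some tuple of elements of the
imaginary sort `RV_lam`, of an `A`-definable subset `W` of `N × RV_lam ^ q`; here `W` is
`A`-definable if its preimage in `N ^ (1 + q)` is. -/
def DefinableOverRV (L : FirstOrder.Language.{u, v}) [L.Structure N] (A : Set N) (lam : Radius O)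
    (X : Set N) : Prop :=
  ∃ (q : ℕ) (W : Set (N × (Fin q → RV lam))) (ξ : Fin q → RV lam),
    A.Definable L {z : Fin (q + 1) → N | (z 0, fun i : Fin q => rv lam (z i.succ)) ∈ W} ∧
      X = {x | (x, ξ) ∈ W}

variable (O)

/-- For residue characteristic `p`: there are only finitely many values between `|p|` and `1`. -/
def IsFinitelyRamified (p : ℕ) : Prop :=
  {γ : O.ValueGroup | O.valuation (p : N) ≤ γ ∧ γ ≤ 1}.Finite

/-- `α` is a pseudo-Cauchy limit over `R`. -/
def IsPCL (R : Set N) (α : N) : Prop :=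
  ∀ a ∈ R, ∃ a' ∈ R, O.valuation (α - a') < O.valuation (α - a)

/-- `S` and `R` (subfields, `R ⊆ S`) have the same value group and the same residue field, both
seen inside those of `N`. -/
def IsImmediate (R S : Set N) : Prop :=
  O.valuation '' S = O.valuation '' R ∧
    IsLocalRing.residue O '' {x : O | (x : N) ∈ S} = IsLocalRing.residue O '' {x : O | (x : N) ∈ R}

end RV

/-- The theory `T` (of valued fields of equi-characteristic `0`) is `0`-h-minimal: in every model,
every `(A ∪ RV)`-definable subset of the field is prepared by a finite `A`-definable set. -/
def IsZeroHMinimal {L : FirstOrder.Language.{u, v}} (φ : valuedField →ᴸ L) (T : L.Theory) : Prop :=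
  ∀ (N : Type w) [Field N] [CharZero N] (O : ValuationSubring N) [L.Structure N],
    IsExpansion φ O → N ⊨ T →
    ∀ A X : Set N, DefinableOverRV L A (Radius.one O) X →
      ∃ C : Set N, C.Finite ∧ A.Definable₁ L C ∧ Prepares (Radius.one O) C X

/-- The theory `T` (of valued fields of characteristic `0`) is `0`-h^mix-minimal: in every model,
for every integer `m' ≥ 1`, every `(A ∪ RV_{|m'|})`-definable subset of the field is
`|m|`-prepared, for some integer `m ≥ 1`, by a finite `A`-definable set. -/
def IsZeroHMixMinimal {L : FirstOrder.Language.{u, v}} (φ : valuedField →ᴸ L) (T : L.Theory) : Prop :=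
  ∀ (N : Type w) [Field N] [CharZero N] (O : ValuationSubring N) [L.Structure N],
    IsExpansion φ O → N ⊨ T →
    ∀ (m' : ℕ+) (A X : Set N), DefinableOverRV L A (Radius.ofNat O m') X →
      ∃ (m : ℕ+) (C : Set N), C.Finite ∧ A.Definable₁ L C ∧ Prepares (Radius.ofNat O m) C X

/-- The model-theoretic algebraic closure of `A`: the union of the finite `A`-definable sets. -/
def acl (L : FirstOrder.Language.{u, v}) {N : Type w} [L.Structure N] (A : Set N) : Set N :=
  {b | ∃ D : Set N, D.Finite ∧ A.Definable₁ L D ∧ b ∈ D}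

/-- The definable closure of `A`: the elements `b` such that `{b}` is `A`-definable. -/
def dcl (L : FirstOrder.Language.{u, v}) {N : Type w} [L.Structure N] (A : Set N) : Set N :=
  {b | A.Definable₁ L {b}}

end HMin

/-!
By compactness, the sets preparing the members of a definable family indexed by `RV_{|m'|}` can be
chosen uniformly: otherwise an ultrapower, which is again a model of the theory, would contain a
fibre that no finite definable set prepares. Let `B = K ∪ {α}`. Since `α` is a pseudo-Cauchy limit,
and by finite ramification, each of its leading terms over finitely many centers in `K` is realized
in `K`. Applying this to the centers preparing a family over `K` shows that every nonempty
`B`-definable set has an element with the same leading term as some element of `K`; call this `(*)`.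

For a finite `B`-definable set `D` with at least two points, `(*)` provides a `B`-definable leading
term of a difference of two of its points. The points of `D` admitting a difference with this
leading term form a nonempty proper subset of `D`, since otherwise one could follow the differences
around a cycle. Inductively, `acl B = dcl B`. Finally, a nonempty `B`-definable set is prepared by
finitely many centers, which thus lie in `dcl B`. Translating by the center closest to some point of
the set and applying `(*)` gives a point of the set in `dcl B`, so the Tarski–Vaught test applies.
Applied to singletons, `(*)` says that `dcl B` has the same leading terms as `K`.
-/

namespace HMin

open FirstOrder FirstOrder.Language FirstOrder.Language.Structure Set Filter

section LeadingTerms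

variable {N : Type w} [Field N] {O : ValuationSubring N} {lam mu : Radius O} {x y : N}

theorem rv_eq_rv_iff :
    rv lam x = rv lam y ↔ x = y ∨ O.valuation (x - y) < lam.1 * O.valuation y := by
  rcases eq_or_ne y 0 with rfl | hy
  · by_cases hx : x = 0 <;> simp [rv, hx]
  have hvy : 0 < O.valuation y := (Valuation.pos_iff _).2 hy
  rcases eq_or_ne x 0 with rfl | hx
  · have : lam.1 * O.valuation y ≤ O.valuation y := mul_le_of_le_one_left' lam.2.2
    simp [rv, hy, hy.symm, Valuation.map_neg, this]
  have quotient_mem : rv lam x = rv lam y ↔ O.valuation (y⁻¹ * x - 1) < lam.1 := by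
    rw [eq_comm]
    simp only [rv, hx, hy, dif_neg, not_false_eq_true]
    rw [WithZero.coe_inj, QuotientGroup.eq]
    simp [oneBall, ← Subgroup.mem_carrier]
  have quotient_sub : y⁻¹ * x - 1 = (x - y) / y := by field_simp
  rw [quotient_mem, quotient_sub, map_div₀, div_lt_iff₀ hvy, iff_or_self]
  rintro rfl
  simpa using mul_pos (zero_lt_iff.2 lam.2.1) hvy

theorem rv_eq_rv_of_valuation_sub_lt (h : O.valuation (x - y) < lam.1 * O.valuation y) :
    rv lam x = rv lam y :=
  rv_eq_rv_iff.2 (Or.inr h)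

theorem valuation_eq_of_rv_eq (h : rv lam x = rv lam y) : O.valuation x = O.valuation y := by
  rcases rv_eq_rv_iff.1 h with rfl | h
  · rfl
  · exact Valuation.map_eq_of_sub_lt _ (h.trans_le (mul_le_of_le_one_left' lam.2.2))

theorem rv_eq_rv_of_le (h : mu.1 ≤ lam.1) (hxy : rv mu x = rv mu y) : rv lam x = rv lam y :=
  rv_eq_rv_iff.2 <| (rv_eq_rv_iff.1 hxy).imp_right fun hlt => hlt.trans_le (mul_le_mul_left h _)

theorem Prepares.mono (h : mu.1 ≤ lam.1) {C D X : Set N} (hCD : C ⊆ D) (hC : Prepares lam C X) :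
    Prepares mu D X :=
  fun x x' hx => hC x x' fun c hc => rv_eq_rv_of_le h (hx c (hCD hc))

theorem Prepares.add_mem {C X : Set N} (hC : Prepares lam C X) {c z a : N} (hz : c + z ∈ X)
    (hmin : ∀ c' ∈ C, O.valuation z ≤ O.valuation (c + z - c')) (h : rv lam z = rv lam a) :
    c + a ∈ X := by
  refine (hC (c + a) (c + z) fun c' hc' => ?_).2 hz
  rcases rv_eq_rv_iff.1 h.symm with rfl | hlt
  · rfl
  refine rv_eq_rv_of_valuation_sub_lt ?_
  rw [sub_sub_sub_cancel_right, add_sub_add_left_eq_sub]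
  exact hlt.trans_le (mul_le_mul_right (hmin c' hc') _)

variable [CharZero N] {m n : ℕ+}

theorem Radius.ofNat_le_of_dvd (h : m ∣ n) : (Radius.ofNat O n).1 ≤ (Radius.ofNat O m).1 := by
  obtain ⟨k, rfl⟩ := h
  simp only [Radius.ofNat, PNat.mul_coe, Nat.cast_mul, map_mul]
  exact mul_le_of_le_one_right' (valuation_natCast_le_one O k)

theorem Radius.ofNat_eq_one (h : O.valuation ((m : ℕ) : N) = 1) : Radius.ofNat O m = Radius.one O :=
  Subtype.ext h

theorem rv_ofNat_eq_iff :
    rv (Radius.ofNat O m) x = rv (Radius.ofNat O m) y ↔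
      x = y ∨ O.valuation (x - y) < O.valuation ((m : ℕ) * y) := by
  rw [rv_eq_rv_iff, map_mul]; rfl

end LeadingTerms

section Definability

variable {L : FirstOrder.Language.{u, v}} {N : Type w} [L.Structure N] {B : Set N} {V : Type*}

theorem definable_and {P Q : (V → N) → Prop} (hP : B.Definable L {v | P v})
    (hQ : B.Definable L {v | Q v}) : B.Definable L {v | P v ∧ Q v} :=
  hP.inter hQ

theorem definable_not {P : (V → N) → Prop} (hP : B.Definable L {v | P v}) :
    B.Definable L {v | ¬ P v} :=
  hP.compl

theorem definable_exists {P : (V → N) → N → Prop}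
    (h : B.Definable L {w : V ⊕ Unit → N | P (fun i => w (.inl i)) (w (.inr ()))}) :
    B.Definable L {v : V → N | ∃ x, P v x} := by
  convert! h.exists_of_finite using 1
  ext v
  exact ⟨fun ⟨x, hx⟩ => ⟨fun _ => x, hx⟩, fun ⟨x, hx⟩ => ⟨x (), hx⟩⟩

theorem definable_mem {X : Set N} (hX : B.Definable₁ L X) {t : (V → N) → N}
    (ht : B.DefinableFun L t) : B.Definable L {v | t v ∈ X} :=
  hX.preimage_map (F := fun v _ => t v) fun _ => ht

theorem definable_mem_family {X : N → Set N} (hX : B.Definable₂ L {z | z.1 ∈ X z.2})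
    {s t : (V → N) → N} (hs : B.DefinableFun L s) (ht : B.DefinableFun L t) :
    B.Definable L {v | s v ∈ X (t v)} :=
  hX.preimage_map (F := fun v => ![s v, t v]) (Fin.forall_fin_two.2 ⟨hs, ht⟩)

theorem definable_exists_mem {P : (V → N) → N → Prop} {X : Set N} (hX : B.Definable₁ L X)
    (hP : B.Definable L {w : V ⊕ Unit → N | P (fun i => w (.inl i)) (w (.inr ()))}) :
    B.Definable L {v : V → N | ∃ x ∈ X, P v x} :=
  definable_exists (definable_and (definable_mem hX (.proj L)) hP)

theorem definable_forall_mem {P : (V → N) → N → Prop} {X : Set N} (hX : B.Definable₁ L X)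
    (hP : B.Definable L {w : V ⊕ Unit → N | P (fun i => w (.inl i)) (w (.inr ()))}) :
    B.Definable L {v : V → N | ∀ x ∈ X, P v x} := by
  simpa only [not_exists, not_and, not_not] using
    definable_not (definable_exists_mem (P := fun v x => ¬ P v x) hX (definable_not hP))

theorem definable₁_of_finite_subset {X : Set N} (hX : X.Finite) (hXB : X ⊆ B) :
    B.Definable₁ L X := by
  induction X, hX using Set.Finite.induction_on with
  | empty => exact definable_empty
  | @insert a s _ _ ih =>
    exact (Definable.singleton_of_mem L (hXB (mem_insert _ _))).union
      (ih ((subset_insert _ _).trans hXB))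

theorem subset_dcl : B ⊆ dcl L B := fun _ hb => Definable.singleton_of_mem L hb

theorem dcl_subset_acl : dcl L B ⊆ acl L B := fun b hb => ⟨{b}, finite_singleton b, hb, rfl⟩

theorem definableFun_const_of_mem_dcl {c : N} (hc : c ∈ dcl L B) :
    B.DefinableFun L fun _ : V → N => c := by
  have := hc.preimage_comp (fun _ => none : Fin 1 → Option V)
  simpa [DefinableFun, Function.tupleGraph, eq_comm] using! this

theorem mem_dcl_of_definableFun {c : N} (hc : B.DefinableFun L fun _ : Fin 1 → N => c) :
    c ∈ dcl L B :=
  (DefinableFun.proj L).ofPred_eq hc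

theorem definable_of_dcl [Finite V] {X : Set (V → N)} (hX : (dcl L B).Definable L X) :
    B.Definable L X := by
  obtain ⟨A₀, hA₀, hX⟩ := definable_iff_finitely_definable.1 hX
  obtain ⟨ψ, rfl⟩ := definable_iff_exists_formula_sum.1 hX
  have hψ : B.Definable L {w | ψ.Realize w} :=
    (empty_definable_iff.2 ⟨ψ, rfl⟩).mono (empty_subset B)
  refine hψ.preimage_map (F := Sum.elim (↑)) (Sum.forall.2 ⟨fun a => ?_, fun _ => .proj L⟩)
  exact definableFun_const_of_mem_dcl (hA₀ a.2)

theorem exists_definable₂_fiber_eq {c : N} {X : Set N} (hX : (B ∪ {c}).Definable₁ L X) :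
    ∃ Y : N → Set N, B.Definable₂ L {z | z.1 ∈ Y z.2} ∧ Y c = X := by
  classical
  obtain ⟨θ, hθ⟩ := definable_iff_exists_formula_sum.1 hX
  let σ : ↥(B ∪ {c}) ⊕ Fin 1 → B ⊕ Fin 2 :=
    Sum.elim (fun b => if h : (b : N) ∈ B then .inl ⟨b, h⟩ else .inr 1) fun _ => .inr 0
  have elim_comp_σ (x : N) : Sum.elim (↑) ![x, c] ∘ σ = Sum.elim (↑) fun _ => x := by
    ext (⟨b, hb⟩ | _)
    · by_cases h : b ∈ B
      · simp [σ, h]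
      · simpa [σ, h] using (hb.resolve_left h).symm
    · simp [σ]
  refine ⟨fun y => {x | (θ.relabel σ).Realize (Sum.elim (↑) ![x, y])},
    definable_iff_exists_formula_sum.2 ⟨θ.relabel σ, ?_⟩, ?_⟩
  · ext v
    have : ![v 0, v 1] = v := funext (Fin.forall_fin_two.2 ⟨rfl, rfl⟩)
    simp only [mem_ofPred_eq, this]
  · ext x
    rw [mem_ofPred_eq, Formula.realize_relabel, elim_comp_σ]
    exact (Set.ext_iff.1 hθ fun _ => x).symm

end Definability

section Expansion

variable {L : FirstOrder.Language.{u, v}} {φ : valuedField →ᴸ L} {N : Type w} [Field N]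
  {O : ValuationSubring N} [L.Structure N]

/-- The function symbol of `L` corresponding to a symbol of the language of rings. -/
def ringSymbol (φ : valuedField →ᴸ L) {n : ℕ} (f : Language.ring.Functions n) : L.Functions n :=
  φ.onFunction (Sum.inl f)

/-- The relation symbol of `L` naming the valuation ring. -/
def integerSymbol (φ : valuedField →ᴸ L) : L.Relations 1 :=
  φ.onRelation (Sum.inr ValRel.integer)

namespace IsExpansion

theorem funMap_add (h : IsExpansion φ O) (x : Fin 2 → N) :
    funMap (ringSymbol φ Ring.addFunc) x = x 0 + x 1 :=
  letI := valuedFieldStructure O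
  h.map_onFunction _ _

theorem funMap_mul (h : IsExpansion φ O) (x : Fin 2 → N) :
    funMap (ringSymbol φ Ring.mulFunc) x = x 0 * x 1 :=
  letI := valuedFieldStructure O
  h.map_onFunction _ _

theorem funMap_neg (h : IsExpansion φ O) (x : Fin 1 → N) :
    funMap (ringSymbol φ Ring.negFunc) x = -x 0 :=
  letI := valuedFieldStructure O
  h.map_onFunction _ _

theorem funMap_zero (h : IsExpansion φ O) (x : Fin 0 → N) :
    funMap (ringSymbol φ Ring.zeroFunc) x = (0 : N) :=
  letI := valuedFieldStructure O
  h.map_onFunction _ _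

theorem funMap_one (h : IsExpansion φ O) (x : Fin 0 → N) :
    funMap (ringSymbol φ Ring.oneFunc) x = (1 : N) :=
  letI := valuedFieldStructure O
  h.map_onFunction _ _

theorem relMap_integer (h : IsExpansion φ O) (x : Fin 1 → N) :
    RelMap (integerSymbol φ) x ↔ x 0 ∈ O :=
  letI := valuedFieldStructure O
  iff_of_eq (h.map_onRelation _ _)

variable {B : Set N} {V : Type*} {s t : (V → N) → N}

theorem definableFun_add (h : IsExpansion φ O) (hs : B.DefinableFun L s)
    (ht : B.DefinableFun L t) : B.DefinableFun L fun v => s v + t v := by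
  simpa only [h.funMap_add] using! DefinableFun.comp (g := fun v => ![s v, t v])
    (Fin.forall_fin_two.2 ⟨hs, ht⟩) (.of_empty (.fun_symbol (ringSymbol φ Ring.addFunc)))

theorem definableFun_mul (h : IsExpansion φ O) (hs : B.DefinableFun L s)
    (ht : B.DefinableFun L t) : B.DefinableFun L fun v => s v * t v := by
  simpa only [h.funMap_mul] using! DefinableFun.comp (g := fun v => ![s v, t v])
    (Fin.forall_fin_two.2 ⟨hs, ht⟩) (.of_empty (.fun_symbol (ringSymbol φ Ring.mulFunc)))

theorem definableFun_sub (h : IsExpansion φ O) (hs : B.DefinableFun L s)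
    (ht : B.DefinableFun L t) : B.DefinableFun L fun v => s v - t v := by
  simp only [sub_eq_add_neg]
  refine h.definableFun_add hs ?_
  simpa only [h.funMap_neg] using! DefinableFun.comp (g := fun v _ => t v)
    (fun _ => ht) (.of_empty (.fun_symbol (ringSymbol φ Ring.negFunc)))

theorem definableFun_natCast (h : IsExpansion φ O) (n : ℕ) :
    B.DefinableFun L fun _ : V → N => (n : N) := by
  induction n with
  | zero =>
    simpa only [Term.realize_func, h.funMap_zero, Nat.cast_zero] using!
      DefinableFun.of_empty (A := B)
        (Term.func (ringSymbol φ Ring.zeroFunc) Fin.elim0 : L.Term V).definableFun_realize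
  | succ n ih =>
    simp only [Nat.cast_succ]
    refine h.definableFun_add ih ?_
    simpa only [Term.realize_func, h.funMap_one] using!
      DefinableFun.of_empty (A := B)
        (Term.func (ringSymbol φ Ring.oneFunc) Fin.elim0 : L.Term V).definableFun_realize

theorem definable₁_integer (h : IsExpansion φ O) : B.Definable₁ L (O : Set N) := by
  refine (empty_definable_iff.2 ⟨(integerSymbol φ).formula fun i => Term.var i, ?_⟩).mono
    (empty_subset B)
  ext v
  exact (h.relMap_integer v).symm

theorem definable_valuation_le (h : IsExpansion φ O) (hs : B.DefinableFun L s)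
    (ht : B.DefinableFun L t) : B.Definable L {v | O.valuation (s v) ≤ O.valuation (t v)} := by
  suffices B.Definable₂ L {z | O.valuation z.1 ≤ O.valuation z.2} from
    definable_mem_family (X := fun y => {x | O.valuation x ≤ O.valuation y}) this hs ht
  have exists_mul_eq {x y : N} :
      O.valuation x ≤ O.valuation y ↔ ∃ a ∈ (O : Set N), a * y = x := by
    simp [ValuationSubring.valuation_le_iff]
  simp only [exists_mul_eq]
  exact definable_exists_mem h.definable₁_integer
    (DefinableFun.ofPred_eq (h.definableFun_mul (.proj L) (.proj L)) (.proj L))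

theorem definable_rv_ofNat_eq (h : IsExpansion φ O) [CharZero N] (m : ℕ+)
    (hs : B.DefinableFun L s) (ht : B.DefinableFun L t) :
    B.Definable L {v | rv (Radius.ofNat O m) (s v) = rv (Radius.ofNat O m) (t v)} := by
  simp only [rv_ofNat_eq_iff, ← not_le]
  exact (hs.ofPred_eq ht).union (definable_not (h.definable_valuation_le
    (h.definableFun_mul (h.definableFun_natCast m) ht) (h.definableFun_sub hs ht)))

end IsExpansion

end Expansion

section ElementaryEmbedding

variable {L : FirstOrder.Language.{u, v}}

theorem definable_image_iff {M N V : Type*} [L.Structure N] {A : Set M} (g : M → N)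
    {X : Set (V → N)} :
    (g '' A).Definable L X ↔
      ∃ ψ : L.Formula (A ⊕ V), X = {v | ψ.Realize (Sum.elim (fun a => g a) v)} := by
  rw [definable_iff_exists_formula_sum]
  constructor
  · rintro ⟨ψ, rfl⟩
    choose σ hσ using fun b : g '' A => b.2
    refine ⟨ψ.relabel (Sum.map (fun b => ⟨σ b, (hσ b).1⟩) id), ?_⟩
    ext v
    have : (fun a : A => g a) ∘ (fun b => ⟨σ b, (hσ b).1⟩) = (↑) := funext fun b => (hσ b).2
    rw [mem_ofPred_eq, mem_ofPred_eq, Formula.realize_relabel, Sum.elim_comp_map, this,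
      Function.comp_id]
  · rintro ⟨ψ, rfl⟩
    refine ⟨ψ.relabel (Sum.map (fun a : A => ⟨g a, mem_image_of_mem g a.2⟩) id), ?_⟩
    ext v
    rw [mem_ofPred_eq, mem_ofPred_eq, Formula.realize_relabel, Sum.elim_comp_map,
      Function.comp_id]
    rfl

variable {φ : valuedField →ᴸ L} {K M : Type*} [L.Structure K] [L.Structure M]

theorem meetsDefinable_range (f : K ↪ₑ[L] M) : L.MeetsDefinable (range f) := by
  rintro D ⟨x, hx⟩ hD
  rw [Definable₁, ← image_univ, definable_image_iff] at hD
  obtain ⟨ψ, hψ⟩ := hD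
  have h : (ψ.iExs (Fin 1)).Realize (f ∘ fun a : (univ : Set K) => (a : K)) :=
    Formula.realize_iExs.2 ⟨fun _ => x, (Set.ext_iff.1 hψ fun _ => x).1 hx⟩
  rw [f.map_formula, Formula.realize_iExs] at h
  obtain ⟨k, hk⟩ := h
  rw [← f.map_formula, Sum.comp_elim] at hk
  exact ⟨f (k 0), (Set.ext_iff.1 hψ (f ∘ k)).2 hk, mem_range_self _⟩

variable [Field K] [Field M] {OK : ValuationSubring K} {OM : ValuationSubring M}

namespace IsExpansion

/-- An elementary embedding of expansions of valued fields, as a homomorphism of fields. -/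
def ringHom (hK : IsExpansion φ OK) (hM : IsExpansion φ OM) (f : K ↪ₑ[L] M) : K →+* M where
  toFun := f
  map_one' := by
    simpa only [hK.funMap_one, hM.funMap_one] using f.map_fun (ringSymbol φ Ring.oneFunc) ![]
  map_zero' := by
    simpa only [hK.funMap_zero, hM.funMap_zero] using f.map_fun (ringSymbol φ Ring.zeroFunc) ![]
  map_add' x y := by
    simpa only [hK.funMap_add, hM.funMap_add] using! f.map_fun (ringSymbol φ Ring.addFunc) ![x, y]
  map_mul' x y := by
    simpa only [hK.funMap_mul, hM.funMap_mul] using! f.map_fun (ringSymbol φ Ring.mulFunc) ![x, y]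

theorem valuation_isEquiv_comap (hK : IsExpansion φ OK) (hM : IsExpansion φ OM)
    (f : K ↪ₑ[L] M) : OK.valuation.IsEquiv (OM.valuation.comap (hK.ringHom hM f)) := by
  refine Valuation.isEquiv_of_val_le_one fun {x} => ?_
  rw [Valuation.comap_apply, OK.valuation_le_one_iff, OM.valuation_le_one_iff]
  have := f.map_rel (integerSymbol φ) ![x]
  rw [hK.relMap_integer, hM.relMap_integer] at this
  exact this.symm

theorem charZero_of_elementaryEmbedding [CharZero K] (hK : IsExpansion φ OK)
    (hM : IsExpansion φ OM) (f : K ↪ₑ[L] M) : CharZero M :=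
  charZero_of_injective_ringHom (hK.ringHom hM f).injective

theorem valuation_natCast_eq_one (hK : IsExpansion φ OK) (hM : IsExpansion φ OM)
    (f : K ↪ₑ[L] M) {n : ℕ} (h : OK.valuation (n : K) = 1) :
    OM.valuation (n : M) = 1 := by
  simpa using (hK.valuation_isEquiv_comap hM f).eq_one_iff_eq_one.1 h

theorem finite_valuation_image_range (hK : IsExpansion φ OK) (hM : IsExpansion φ OM)
    (f : K ↪ₑ[L] M) {n : ℕ} (h : IsFinitelyRamified OK n) :
    {γ ∈ OM.valuation '' range f | OM.valuation (n : M) ≤ γ ∧ γ ≤ 1}.Finite := by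
  have equiv := hK.valuation_isEquiv_comap hM f
  have factors : Function.FactorsThrough (OM.valuation ∘ f) OK.valuation :=
    fun _ _ => equiv.eq_iff.1
  obtain ⟨e, he⟩ := (Function.factorsThrough_iff _).1 factors
  refine (h.image e).subset ?_
  rintro _ ⟨⟨_, ⟨k, rfl⟩, rfl⟩, hnk, hk⟩
  refine ⟨OK.valuation k, ⟨equiv.le_iff_le.2 ?_, equiv.le_one_iff_le_one.2 hk⟩,
    (congrFun he k).symm⟩
  simpa using! hnk

end IsExpansion

end ElementaryEmbedding

section Ultrapower

variable {L : FirstOrder.Language.{u, v}} {φ : valuedField →ᴸ L} {I : Type*} (U : Ultrafilter I)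
  {M : Type w}

/-- The `L`-structure of an ultrapower. -/
@[reducible] def germStructure [L.Structure M] : L.Structure (Germ (U : Filter I) M) :=
  Ultraproduct.structure (M := fun _ => M) (u := U)

attribute [local instance] germStructure

variable {U} in
/-- The internal subset of an ultrapower given by a germ of subsets. -/
def germSet (S : Germ (U : Filter I) (Set M)) : Set (Germ (U : Filter I) M) :=
  {x | x.LiftRel (· ∈ ·) S}

theorem exists_coe_eq {V : Type*} (v : V → Germ (U : Filter I) M) :
    ∃ x : V → I → M, (fun b => (x b : Germ (U : Filter I) M)) = v :=
  ⟨fun b => (v b).out, funext fun _ => Quotient.out_eq' _⟩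

section Structure

variable [L.Structure M] [Nonempty M]

theorem realize_germ {V : Type*} (θ : L.Formula V) (x : V → I → M) :
    θ.Realize (fun b => (x b : Germ (U : Filter I) M)) ↔ ∀ᶠ i in U, θ.Realize fun b => x b i :=
  Ultraproduct.realize_formula_cast (M := fun _ => M) θ x

/-- The diagonal embedding into an ultrapower. -/
def germConst : M ↪ₑ[L] Germ (U : Filter I) M where
  toFun a := (a : Germ (U : Filter I) M)
  map_formula' _ θ x := (realize_germ U θ fun b _ => x b).trans eventually_const

variable {A : Set M}

theorem realize_germ_sumElim {V : Type*} (θ : L.Formula (A ⊕ V)) (x : V → I → M) :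
    θ.Realize (Sum.elim (fun a => germConst (L := L) U (a : M))
        fun b => (x b : Germ (U : Filter I) M)) ↔
      ∀ᶠ i in U, θ.Realize (Sum.elim (↑) fun b => x b i) := by
  convert! realize_germ U θ (Sum.elim (fun a _ => (a : M)) x) using 3
  · rename_i b
    rcases b with b | b <;> rfl
  · rename_i i
    refine iff_of_eq (congrArg _ ?_)
    ext (b | b) <;> rfl

theorem definable₂_germSet_map {X : M → Set M} (hX : A.Definable₂ L {z | z.1 ∈ X z.2}) :
    (germConst (L := L) U '' A).Definable₂ L {z | z.1 ∈ germSet (z.2.map X)} := by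
  obtain ⟨θ, hθ⟩ := definable_iff_exists_formula_sum.1 hX
  refine (definable_image_iff _).2 ⟨θ, ?_⟩
  ext v
  obtain ⟨x, rfl⟩ := exists_coe_eq U v
  exact (eventually_congr (.of_forall fun i => Set.ext_iff.1 hθ fun b => x b i)).trans
    (realize_germ_sumElim U θ x).symm

theorem exists_germSet_coe_eq {D : Set (Germ (U : Filter I) M)}
    (hD : (germConst (L := L) U '' A).Definable₁ L D) :
    ∃ C : Set M, A.Definable₁ L C ∧ germSet ↑C = D := by
  obtain ⟨θ, hθ⟩ := (definable_image_iff _).1 hD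
  refine ⟨{x | θ.Realize (Sum.elim (↑) fun _ => x)}, definable_iff_exists_formula_sum.2 ⟨θ, ?_⟩, ?_⟩
  · ext v
    have : (fun _ => v 0) = v := funext fun i => congrArg v (Subsingleton.elim _ _)
    rw [mem_ofPred_eq, mem_ofPred_eq, mem_ofPred_eq, this]
  · ext x
    induction x using Germ.inductionOn with
    | _ x =>
      exact (realize_germ_sumElim U θ fun _ => x).symm.trans
        (Set.ext_iff.1 hθ fun _ => (x : Germ (U : Filter I) M)).symm

end Structure

theorem finite_of_finite_germSet_coe {C : Set M}
    (h : (germSet (C : Germ (U : Filter I) (Set M))).Finite) : C.Finite :=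
  .of_finite_image (f := fun c => (c : Germ (U : Filter I) M))
    (h.subset (image_subset_iff.2 fun _ hc => Eventually.of_forall fun _ => hc))
    fun _ _ _ _ hcd => eventually_const.1 (Germ.coe_eq.1 hcd)

variable [Field M] {O : ValuationSubring M}

variable (O) in
/-- The ultrapower of a valuation ring. -/
def germValuationSubring : ValuationSubring (Germ (U : Filter I) M) where
  carrier := {x | x.LiftPred (· ∈ O)}
  mul_mem' {a b} ha hb := by
    induction a using Germ.inductionOn
    induction b using Germ.inductionOn
    exact (Eventually.and ha hb).mono fun _ h => O.mul_mem _ _ h.1 h.2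
  add_mem' {a b} ha hb := by
    induction a using Germ.inductionOn
    induction b using Germ.inductionOn
    exact (Eventually.and ha hb).mono fun _ h => O.add_mem _ _ h.1 h.2
  one_mem' := .of_forall fun _ => O.one_mem
  zero_mem' := .of_forall fun _ => O.zero_mem
  neg_mem' {a} ha := by
    induction a using Germ.inductionOn
    exact Eventually.mono ha fun _ h => O.neg_mem _ h
  mem_or_inv_mem' a := by
    induction a using Germ.inductionOn with
    | _ f => exact Ultrafilter.eventually_or.1 (.of_forall fun i => O.mem_or_inv_mem (f i))

theorem IsExpansion.germ [L.Structure M] (h : IsExpansion φ O) :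
    IsExpansion φ (germValuationSubring U O) := by
  let := valuedFieldStructure O
  let := valuedFieldStructure (germValuationSubring U O)
  refine ⟨fun {n} f x => ?_, fun {n} r x => ?_⟩ <;> obtain ⟨y, rfl⟩ := exists_coe_eq U x
  · refine (Ultraproduct.funMap_cast (M := fun _ => M) (u := U) (φ.onFunction f) y).trans ?_
    have : (fun a => funMap (φ.onFunction f) fun i => y i a) = fun a => funMap f fun i => y i a :=
      funext fun a => h.map_onFunction f _
    rw [this]
    rcases f with f | f
    · cases f <;> rfl
    · exact f.elim
  · rcases r with r | r
    · exact r.elim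
    cases r
    refine propext <| (relMap_quotient_mk' (s := productSetoid (U : Filter I) fun _ => M)
      (ps := Ultraproduct.setoidPrestructure (fun _ => M) U) _ _).trans ?_
    exact eventually_congr (.of_forall fun i => iff_of_eq (h.map_onRelation _ _))

variable [CharZero M]

theorem germ_charZero : CharZero (Germ (U : Filter I) M) :=
  ⟨fun _ _ hab => Nat.cast_injective (eventually_const.1 (Germ.coe_eq.1 hab))⟩

attribute [local instance] germ_charZero

-- In this form equality of leading terms is visibly a Boolean combination of atomic conditions, so
-- that it passes to ultrapowers.
theorem rv_ofNat_eq_iff_notMem {m : ℕ+} {x y : M} :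
    rv (Radius.ofNat O m) x = rv (Radius.ofNat O m) y ↔ x = y ∨ (m : ℕ) * y / (x - y) ∉ O := by
  rw [rv_ofNat_eq_iff]
  refine or_congr_right' fun hxy => ?_
  rw [← O.valuation_le_one_iff, map_div₀, not_le,
    one_lt_div₀ ((Valuation.pos_iff _).2 (sub_ne_zero.2 hxy))]

theorem rv_germ_eq_iff {m : ℕ+} {x y : I → M} :
    rv (Radius.ofNat (germValuationSubring U O) m) (x : Germ (U : Filter I) M) =
        rv (Radius.ofNat (germValuationSubring U O) m) (y : Germ (U : Filter I) M) ↔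
      ∀ᶠ i in U, rv (Radius.ofNat O m) (x i) = rv (Radius.ofNat O m) (y i) := by
  simp only [rv_ofNat_eq_iff_notMem]
  rw [Ultrafilter.eventually_or, Ultrafilter.eventually_not]
  exact or_congr Germ.coe_eq Iff.rfl

theorem Prepares.eventually_of_germ {m : ℕ+} {C X : I → Set M}
    (h : Prepares (Radius.ofNat (germValuationSubring U O) m)
      (germSet (C : Germ (U : Filter I) (Set M))) (germSet ↑X)) :
    ∀ᶠ i in U, Prepares (Radius.ofNat O m) (C i) (X i) := by
  by_contra hcon
  rw [← Ultrafilter.eventually_not] at hcon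
  simp only [Prepares, not_forall] at hcon
  obtain ⟨x, hx⟩ := hcon.choice
  obtain ⟨x', hx'⟩ := hx.choice
  have mem_iff : ∀ᶠ i in U, x i ∈ X i ↔ x' i ∈ X i := by
    have := h (x : Germ (U : Filter I) M) x' fun c hc => ?_
    · by_cases hX : ∀ᶠ i in U, x i ∈ X i
      · exact (hX.and (this.1 hX)).mono fun i hi => iff_of_true hi.1 hi.2
      · exact ((Ultrafilter.eventually_not.2 hX).and (Ultrafilter.eventually_not.2
          (mt this.2 hX))).mono fun i hi => iff_of_false hi.1 hi.2
    · induction c using Germ.inductionOn with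
      | _ c =>
        refine (rv_germ_eq_iff U (x := fun i => x i - c i) (y := fun i => x' i - c i)).2 ?_
        filter_upwards [hc, hx'] with i hci ⟨hrv, _⟩
        exact hrv _ hci
  obtain ⟨i, hi, _, hi'⟩ := (mem_iff.and hx').exists
  exact hi' hi

end Ultrapower

section UniformPreparation

variable {L : FirstOrder.Language.{u, v}} {φ : valuedField →ᴸ L} {M : Type w} [Field M] [CharZero M]
  {O : ValuationSubring M} [L.Structure M]

variable (L O) in
/-- The conclusion of `0`-h^mix-minimality for a single valued field. -/
def HasPreparation : Prop :=
  ∀ (m' : ℕ+) (A X : Set M), DefinableOverRV L A (Radius.ofNat O m') X →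
    ∃ (m : ℕ+) (C : Set M), C.Finite ∧ A.Definable₁ L C ∧ Prepares (Radius.ofNat O m) C X

variable (L O) in
/-- A definable family indexed by `RV_{|m'|}`, encoded as a family `X` over the field which is
constant on the fibres of `rv`, is prepared by a single finite set defined over the parameters
of `X`. -/
def HasUniformPreparation : Prop :=
  ∀ (m' : ℕ+) (A : Set M) (X : M → Set M), A.Definable₂ L {z | z.1 ∈ X z.2} →
    (∀ ξ ξ', rv (Radius.ofNat O m') ξ = rv (Radius.ofNat O m') ξ' → X ξ = X ξ') →
      ∃ (m : ℕ+) (C : Set M), C.Finite ∧ A.Definable₁ L C ∧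
        ∀ ξ, Prepares (Radius.ofNat O m) C (X ξ)

theorem IsExpansion.definableOverRV_of_invariant (h : IsExpansion φ O) {m : ℕ+} {A : Set M}
    {X : M → Set M} (hX : A.Definable₂ L {z | z.1 ∈ X z.2})
    (hinv : ∀ ξ ξ', rv (Radius.ofNat O m) ξ = rv (Radius.ofNat O m) ξ' → X ξ = X ξ') (ξ : M) :
    DefinableOverRV L A (Radius.ofNat O m) (X ξ) := by
  refine ⟨1, {z | ∃ η, rv _ η = z.2 0 ∧ z.1 ∈ X η}, fun _ => rv _ ξ, ?_, ?_⟩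
  · exact definable_exists (definable_and (h.definable_rv_ofNat_eq m (.proj L) (.proj L))
      (definable_mem_family hX (.proj L) (.proj L)))
  · ext x
    exact ⟨fun hx => ⟨ξ, rfl, hx⟩, fun ⟨η, hη, hx⟩ => hinv η ξ hη ▸ hx⟩

theorem HasPreparation.exists_eventually_prepares {I : Type*} (U : Ultrafilter I)
    (hM : IsExpansion φ O)
    (hprep : letI := germStructure (L := L) U (M := M)
      haveI := germ_charZero U (M := M)
      HasPreparation L (germValuationSubring U O)) {m' : ℕ+} {A : Set M} {X : M → Set M}
    (hX : A.Definable₂ L {z | z.1 ∈ X z.2})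
    (hinv : ∀ ξ ξ', rv (Radius.ofNat O m') ξ = rv (Radius.ofNat O m') ξ' → X ξ = X ξ')
    (ξ : I → M) :
    ∃ (m : ℕ+) (C : Set M), C.Finite ∧ A.Definable₁ L C ∧
      ∀ᶠ i in U, Prepares (Radius.ofNat O m) C (X (ξ i)) := by
  let := germStructure (L := L) U (M := M)
  have := germ_charZero U (M := M)
  have germ_invariant (η η' : Germ (U : Filter I) M)
      (h : rv (Radius.ofNat (germValuationSubring U O) m') η =
        rv (Radius.ofNat (germValuationSubring U O) m') η') :
      germSet (η.map X) = germSet (η'.map X) := by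
    induction η using Germ.inductionOn
    induction η' using Germ.inductionOn
    exact congrArg germSet (Germ.coe_eq.2 (((rv_germ_eq_iff U).1 h).mono fun i => hinv _ _))
  obtain ⟨m, D, hDfin, hD, hDX⟩ := hprep m' _ _
    ((hM.germ U).definableOverRV_of_invariant (definable₂_germSet_map U hX) germ_invariant ξ)
  obtain ⟨C, hC, rfl⟩ := exists_germSet_coe_eq U hD
  exact ⟨m, C, finite_of_finite_germSet_coe U hDfin, hC, Prepares.eventually_of_germ U hDX⟩

theorem exists_finset_forall_exists_mem {T X : Type*} {P : T → X → Prop}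
    (h : ∀ (U : Ultrafilter (Finset T)) (ξ : Finset T → X), ∃ t, ∀ᶠ s in U, P t (ξ s)) :
    ∃ s : Finset T, ∀ ξ, ∃ t ∈ s, P t ξ := by
  classical
  by_contra! hcon
  choose ξ hξ using hcon
  let U : Ultrafilter (Finset T) := Ultrafilter.of atTop
  obtain ⟨t, ht⟩ := h U ξ
  have eventually_mem : ∀ᶠ s in (U : Filter (Finset T)), t ∈ s :=
    Ultrafilter.of_le atTop
      ((eventually_ge_atTop {t}).mono fun _ hs => Finset.singleton_subset_iff.1 hs)
  obtain ⟨s, hs, hts⟩ := (ht.and eventually_mem).exists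
  exact hξ s t hts hs

theorem HasUniformPreparation.of_elementaryEmbedding (hM : IsExpansion φ O)
    (hprep : ∀ (N : Type max u v w) [Field N] [CharZero N] (O' : ValuationSubring N)
      [L.Structure N], IsExpansion φ O' → (M ↪ₑ[L] N) → HasPreparation L O') :
    HasUniformPreparation L O := by
  intro m' A X hX hinv
  let T := ULift.{max u v} ({C : Set M // C.Finite ∧ A.Definable₁ L C} × ℕ+)
  obtain ⟨s, hs⟩ : ∃ s : Finset T, ∀ ξ, ∃ t ∈ s,
      Prepares (Radius.ofNat O t.down.2) t.down.1 (X ξ) := by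
    refine exists_finset_forall_exists_mem fun U ξ => ?_
    let := germStructure (L := L) U (M := M)
    have := germ_charZero U (M := M)
    obtain ⟨m, C, hCfin, hC, hCX⟩ := HasPreparation.exists_eventually_prepares U hM
      (hprep _ _ (hM.germ U) (germConst U)) hX hinv ξ
    exact ⟨⟨⟨C, hCfin, hC⟩, m⟩, hCX⟩
  refine ⟨∏ t ∈ s, t.down.2, ⋃ t ∈ s, t.down.1, ?_, ?_, fun ξ => ?_⟩
  · exact s.finite_toSet.biUnion fun t _ => t.down.1.2.1
  · unfold Definable₁
    convert! definable_biUnion_finset (fun t : T => t.down.1.2.2) s using 1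
    ext
    simp
  · obtain ⟨t, hts, hprep⟩ := hs ξ
    exact hprep.mono (Radius.ofNat_le_of_dvd (Finset.dvd_prod_of_mem (fun t : T => t.down.2) hts))
      (subset_biUnion_of_mem (u := fun t : T => (t.down.1 : Set M)) hts)

end UniformPreparation

section PseudoCauchyLimit

variable {M : Type w} [Field M] {O : ValuationSubring M} {α : M}

/-- Finitely many conditions on the leading terms of the differences `α - c`, with `c ∈ A`, can be
met by an element of `A` in place of `α`. -/
def IsLeadingTermLimit [CharZero M] (O : ValuationSubring M) (A : Set M) (α : M) : Prop :=
  ∀ (m : ℕ+) (C : Set M), C.Finite → C ⊆ A →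
    ∃ a ∈ A, ∀ c ∈ C, rv (Radius.ofNat O m) (α - c) = rv (Radius.ofNat O m) (a - c)

theorem IsPCL.exists_valuation_sub_eq {A : Set M} (hα : IsPCL O A α) {a : M} (ha : a ∈ A) :
    ∃ b ∈ A, O.valuation (a - b) = O.valuation (α - a) := by
  obtain ⟨b, hb, hlt⟩ := hα a ha
  refine ⟨b, hb, ?_⟩
  rw [← sub_sub_sub_cancel_left b a α]
  exact Valuation.map_sub_eq_of_lt_right _ hlt

theorem IsPCL.exists_valuation_sub_lt_mul {A : Subfield M} (hα : IsPCL O A α) {r : M}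
    (hr : {γ ∈ O.valuation '' A | O.valuation r ≤ γ ∧ γ ≤ 1}.Finite) {c : M} (hc : c ∈ A) :
    ∃ a ∈ A, O.valuation (α - a) < O.valuation (r * (α - c)) := by
  by_contra! hfar
  obtain ⟨b, -, hlt⟩ := hα c hc
  have hc_pos : 0 < O.valuation (α - c) := zero_le.trans_lt hlt
  let s : Set M := {a ∈ A | O.valuation (α - a) ≤ O.valuation (α - c)}
  have ratio_finite : ((fun a => O.valuation (α - a) / O.valuation (α - c)) '' s).Finite := by
    refine hr.subset ?_
    rintro _ ⟨a, ⟨ha, hac⟩, rfl⟩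
    obtain ⟨a', ha', haa'⟩ := hα.exists_valuation_sub_eq ha
    obtain ⟨c', hc', hcc'⟩ := hα.exists_valuation_sub_eq hc
    refine ⟨⟨(a - a') / (c - c'), A.div_mem (A.sub_mem ha ha') (A.sub_mem hc hc'), ?_⟩, ?_, ?_⟩
    · rw [map_div₀, haa', hcc']
    · rw [le_div_iff₀ hc_pos, ← map_mul]
      exact hfar a ha
    · exact div_le_one_of_le₀ hac zero_le
  obtain ⟨a, ⟨ha, hac⟩, hmin⟩ := ratio_finite.exists_minimalFor' _ s ⟨c, hc, le_rfl⟩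
  obtain ⟨a', ha', hlt'⟩ := hα a ha
  have ratio_lt : O.valuation (α - a') / O.valuation (α - c) <
      O.valuation (α - a) / O.valuation (α - c) := div_lt_div_of_pos_right hlt' hc_pos
  exact ratio_lt.not_ge (hmin ⟨ha', hlt'.le.trans hac⟩ ratio_lt.le)

theorem exists_valuation_sub_lt_natCast_mul {A : Set M}
    (h : ∀ l : ℕ, l.Prime → ∀ c ∈ A, ∃ a ∈ A, O.valuation (α - a) < O.valuation (l * (α - c)))
    (hα : IsPCL O A α) {m : ℕ} (hm : m ≠ 0) {c : M} (hc : c ∈ A) :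
    ∃ a ∈ A, O.valuation (α - a) < O.valuation (m * (α - c)) := by
  induction m using Nat.recOnMul generalizing c with
  | zero => exact absurd rfl hm
  | one => simpa using hα c hc
  | prime l hl => exact h l hl c hc
  | mul m n ihm ihn =>
    obtain ⟨a, ha, hac⟩ := ihm (left_ne_zero_of_mul hm) hc
    obtain ⟨b, hb, hba⟩ := ihn (right_ne_zero_of_mul hm) ha
    refine ⟨b, hb, hba.trans_le ?_⟩
    rw [Nat.cast_mul, mul_comm (m : M), mul_assoc, map_mul _ (n : M), map_mul _ (n : M)]
    exact mul_le_mul_right hac.le _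

theorem exists_forall_valuation_sub_lt {A C : Set M} {γ : M → O.ValueGroup} (hA : A.Nonempty)
    (h : ∀ c ∈ A, ∃ a ∈ A, O.valuation (α - a) < γ c) (hC : C.Finite) (hCA : C ⊆ A) :
    ∃ a ∈ A, ∀ c ∈ C, O.valuation (α - a) < γ c := by
  choose! g hgA hg using h
  rcases C.eq_empty_or_nonempty with rfl | hCne
  · exact hA.imp fun a ha => ⟨ha, by simp⟩
  obtain ⟨c, hc, hmin⟩ := exists_min_image C (fun c => O.valuation (α - g c)) hC hCne
  exact ⟨g c, hgA c (hCA hc), fun d hd => (hmin d hd).trans_lt (hg d (hCA hd))⟩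

theorem IsPCL.isLeadingTermLimit [CharZero M] {A : Subfield M} (hα : IsPCL O A α)
    (hram : ∀ l : ℕ, l.Prime →
      {γ ∈ O.valuation '' A | O.valuation (l : M) ≤ γ ∧ γ ≤ 1}.Finite) :
    IsLeadingTermLimit O A α := by
  intro m C hC hCA
  obtain ⟨a, ha, hlt⟩ := exists_forall_valuation_sub_lt ⟨0, A.zero_mem⟩
    (fun c hc => exists_valuation_sub_lt_natCast_mul
      (fun l hl c hc => hα.exists_valuation_sub_lt_mul (hram l hl) hc) hα m.ne_zero hc) hC hCA
  refine ⟨a, ha, fun c hc => (rv_ofNat_eq_iff.2 (.inr ?_)).symm⟩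
  rw [sub_sub_sub_cancel_right, Valuation.map_sub_swap]
  exact hlt c hc

end PseudoCauchyLimit

section Cycle

theorem ncard_factorial_nsmul_eq_zero_of_add_mem {G : Type*} [AddGroup G] {E : Set G}
    (hE : E.Finite) (hne : E.Nonempty) {g : G} (h : ∀ e ∈ E, e + g ∈ E) :
    E.ncard.factorial • g = 0 := by
  obtain ⟨e, he⟩ := hne
  have add_nsmul_mem (i : ℕ) : e + i • g ∈ E := by
    induction i with
    | zero => simpa
    | succ i ih => simpa only [succ_nsmul, ← add_assoc] using h _ ih
  have card_lt : hE.toFinset.card < (Finset.range (E.ncard + 1)).card := by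
    rw [Finset.card_range, ← ncard_eq_toFinset_card E hE]
    exact Nat.lt_succ_self _
  obtain ⟨i, hi, j, hj, hij, heq⟩ := Finset.exists_ne_map_eq_of_card_lt_of_maps_to card_lt
    (f := fun i => e + i • g) fun i _ => by simpa using add_nsmul_mem i
  wlog hlt : i < j generalizing i j
  · exact this j hj i hi hij.symm heq.symm (hij.symm.lt_of_le (not_lt.1 hlt))
  have sub_nsmul : (j - i) • g = 0 := by
    rw [sub_nsmul _ hlt.le, add_left_cancel heq, add_neg_cancel]
  have sub_dvd : j - i ∣ E.ncard.factorial := by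
    rw [Finset.mem_range, Nat.lt_succ_iff] at hj
    exact Nat.dvd_factorial (Nat.sub_pos_of_lt hlt) ((Nat.sub_le _ _).trans hj)
  obtain ⟨r, hr⟩ := sub_dvd
  rw [hr, mul_comm, mul_nsmul', sub_nsmul, nsmul_zero]

-- Otherwise translation by `-k` maps the image of `D` modulo the open ball of radius `|m k|` to
-- itself, and then `m k` would lie in this ball.
theorem exists_forall_rv_sub_ne {M : Type w} [Field M] [CharZero M] {O : ValuationSubring M}
    {D : Set M} (hD : D.Finite) (hne : D.Nonempty) {m : ℕ+} (hm : D.ncard.factorial ∣ m)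
    {k : M} (hk : k ≠ 0) :
    ∃ x ∈ D, ∀ y ∈ D, rv (Radius.ofNat O m) (x - y) ≠ rv (Radius.ofNat O m) k := by
  by_contra! hcon
  have mk_ne_zero : (m : ℕ) * k ≠ 0 := mul_ne_zero (Nat.cast_ne_zero.2 m.ne_zero) hk
  have mk_pos : 0 < O.valuation ((m : ℕ) * k) := (Valuation.pos_iff _).2 mk_ne_zero
  let H : AddSubgroup M := O.valuation.ltAddSubgroup (Units.mk0 _ mk_pos.ne')
  let E : Set (M ⧸ H) := (↑) '' D
  have add_mem : ∀ e ∈ E, e + ((-k : M) : M ⧸ H) ∈ E := by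
    rintro _ ⟨x, hx, rfl⟩
    obtain ⟨y, hy, hrv⟩ := hcon x hx
    refine ⟨y, hy, QuotientAddGroup.eq.2 ?_⟩
    change O.valuation (-y + (x + -k)) < _
    have : -y + (x + -k) = x - y - k := by ring
    rw [this]
    rcases rv_ofNat_eq_iff.1 hrv with h | h
    · simpa [h] using! mk_pos
    · exact h
  have dvd_m : E.ncard.factorial ∣ m :=
    (Nat.factorial_dvd_factorial (ncard_image_le hD)).trans hm
  have nsmul_eq_zero : (m : ℕ) • ((-k : M) : M ⧸ H) = 0 := by
    obtain ⟨r, hr⟩ := dvd_m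
    rw [hr, mul_comm, mul_nsmul', ncard_factorial_nsmul_eq_zero_of_add_mem (hD.image _)
      (hne.image _) add_mem, nsmul_zero]
  rw [← QuotientAddGroup.mk_nsmul, QuotientAddGroup.eq_zero_iff, nsmul_eq_mul, mul_neg,
    neg_mem_iff] at nsmul_eq_zero
  exact lt_irrefl (O.valuation ((m : ℕ) * k)) nsmul_eq_zero

end Cycle

section Closure

variable {L : FirstOrder.Language.{u, v}} {N : Type w} [L.Structure N] {A B : Set N}

theorem subset_of_meetsDefinable (hA : L.MeetsDefinable A) {C : Set N} (hC : C.Finite)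
    (hCA : A.Definable₁ L C) : C ⊆ A := by
  by_contra hsub
  have inter_definable : A.Definable₁ L (C ∩ A) :=
    definable₁_of_finite_subset (hC.subset inter_subset_left) inter_subset_right
  have sdiff_definable : A.Definable₁ L (C \ (C ∩ A)) := Definable.sdiff hCA inter_definable
  rw [sdiff_self_inter] at sdiff_definable
  obtain ⟨x, hx, hxA⟩ := hA _ (sdiff_nonempty.2 hsub) sdiff_definable
  exact hx.2 hxA

theorem acl_eq_dcl_of_forall_exists_ssubset
    (h : ∀ D : Set N, D.Finite → D.Nontrivial → B.Definable₁ L D →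
      ∃ D₁ ⊂ D, D₁.Nonempty ∧ B.Definable₁ L D₁) :
    acl L B = dcl L B := by
  refine Subset.antisymm ?_ dcl_subset_acl
  rintro b ⟨D, hfin, hD, hb⟩
  induction hn : D.ncard using Nat.strong_induction_on generalizing D with
  | _ n ih =>
    subst hn
    rcases D.subsingleton_or_nontrivial with hsub | hnt
    · rwa [hsub.eq_singleton_of_mem hb] at hD
    obtain ⟨D₁, hss, hne, hD₁⟩ := h D hfin hnt hD
    by_cases hbD₁ : b ∈ D₁
    · exact ih _ (ncard_lt_ncard hss hfin) D₁ (hfin.subset hss.1) hD₁ hbD₁ rfl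
    · have sdiff_ssubset : D \ D₁ ⊂ D :=
        ⟨sdiff_subset, fun hsub => hne.elim fun x hx => (hsub (hss.1 hx)).2 hx⟩
      exact ih _ (ncard_lt_ncard sdiff_ssubset hfin) (D \ D₁) (hfin.subset sdiff_ssubset.1)
        (Definable.sdiff hD hD₁) ⟨hb, hbD₁⟩ rfl

variable {φ : valuedField →ᴸ L} [Field N] [CharZero N] {O : ValuationSubring N} {α : N}

variable (L O) in
/-- Every nonempty `B`-definable subset of the field contains, for each `m`, an element with the
same leading term in `RV_{|m|}` as some element of `A`. -/
def RVMeetsDefinable (B A : Set N) : Prop :=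
  ∀ (m : ℕ+) (Z : Set N), B.Definable₁ L Z → Z.Nonempty →
    ∃ z ∈ Z, ∃ a ∈ A, rv (Radius.ofNat O m) z = rv (Radius.ofNat O m) a

theorem RVMeetsDefinable.image_rv_dcl (h : RVMeetsDefinable L O B A) (hAB : A ⊆ B) :
    rv (Radius.one O) '' dcl L B = rv (Radius.one O) '' A := by
  refine Subset.antisymm ?_ (image_mono (hAB.trans subset_dcl))
  rintro _ ⟨b, hb, rfl⟩
  obtain ⟨_, rfl, a, ha, hba⟩ := h 1 {b} hb (singleton_nonempty b)
  rw [Radius.ofNat_eq_one (by simp)] at hba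
  exact ⟨a, ha, hba.symm⟩

theorem IsLeadingTermLimit.rvMeetsDefinable (hM : IsExpansion φ O)
    (hα : IsLeadingTermLimit O A α) (hA : L.MeetsDefinable A) (hprep : HasUniformPreparation L O) :
    RVMeetsDefinable L O (A ∪ {α}) A := by
  intro m Z hZ hne
  obtain ⟨Y, hY, rfl⟩ := exists_definable₂_fiber_eq hZ
  let X (ξ : N) : Set N := {x | ∃ z, rv (Radius.ofNat O m) z = rv (Radius.ofNat O m) ξ ∧ z ∈ Y x}
  have hX : A.Definable₂ L {z | z.1 ∈ X z.2} :=
    definable_exists (definable_and (hM.definable_rv_ofNat_eq m (.proj L) (.proj L))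
      (definable_mem_family hY (.proj L) (.proj L)))
  obtain ⟨n, C, hCfin, hC, hCX⟩ := hprep m A X hX fun ξ ξ' h => by simp only [X, h]
  obtain ⟨a, ha, hαa⟩ := hα n C hCfin (subset_of_meetsDefinable hA hCfin hC)
  have mem_iff (ξ : N) : α ∈ X ξ ↔ a ∈ X ξ := hCX ξ α a hαa
  have fiber_definable : A.Definable₁ L {ξ | a ∈ X ξ} :=
    definable_mem_family hX (definableFun_const_of_mem_dcl (subset_dcl ha)) (.proj L)
  obtain ⟨z, hz⟩ := hne
  obtain ⟨ξ, hξ, hξA⟩ := hA _ ⟨z, (mem_iff z).1 ⟨z, rfl, hz⟩⟩ fiber_definable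
  obtain ⟨y, hyξ, hy⟩ := (mem_iff ξ).2 hξ
  exact ⟨y, hy, ξ, hξA, hyξ⟩

theorem RVMeetsDefinable.exists_ssubset_definable₁ (hM : IsExpansion φ O)
    (h : RVMeetsDefinable L O B A) (hAB : A ⊆ B) {D : Set N} (hfin : D.Finite)
    (hnt : D.Nontrivial) (hD : B.Definable₁ L D) :
    ∃ D₁ ⊂ D, D₁.Nonempty ∧ B.Definable₁ L D₁ := by
  let m : ℕ+ := ⟨D.ncard.factorial, Nat.factorial_pos _⟩
  have differences_definable : B.Definable₁ L {z | z ≠ 0 ∧ ∃ x ∈ D, x - z ∈ D} := by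
    refine definable_and (definable_not ?_) (definable_exists_mem hD
      (definable_mem hD (hM.definableFun_sub (.proj L) (.proj L))))
    exact DefinableFun.ofPred_eq (.proj L) (by simpa using! hM.definableFun_natCast 0)
  obtain ⟨x, hx, y, hy, hxy⟩ := hnt
  obtain ⟨z, ⟨hz0, x, hx, hxz⟩, k, hk, hzk⟩ :=
    h m _ differences_definable ⟨x - y, sub_ne_zero.2 hxy, x, hx, by simpa using hy⟩
  have hk0 : k ≠ 0 := by
    rw [← O.valuation.ne_zero_iff, ← valuation_eq_of_rv_eq hzk]
    exact O.valuation.ne_zero_iff.2 hz0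
  obtain ⟨t, ht, htk⟩ := exists_forall_rv_sub_ne (O := O) hfin ⟨x, hx⟩ (m := m) dvd_rfl hk0
  refine ⟨{x ∈ D | ∃ y ∈ D, rv (Radius.ofNat O m) (x - y) = rv (Radius.ofNat O m) k},
    ⟨sep_subset _ _, fun hsub => ?_⟩, ⟨x, hx, x - z, hxz, by rwa [sub_sub_cancel]⟩, ?_⟩
  · obtain ⟨-, y, hy, htyk⟩ := hsub ht
    exact htk y hy htyk
  · exact definable_and (definable_mem hD (.proj L)) (definable_exists_mem hD
      (hM.definable_rv_ofNat_eq m (hM.definableFun_sub (.proj L) (.proj L))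
        (definableFun_const_of_mem_dcl (subset_dcl (hAB hk)))))

theorem RVMeetsDefinable.acl_eq_dcl (hM : IsExpansion φ O) (h : RVMeetsDefinable L O B A)
    (hAB : A ⊆ B) : acl L B = dcl L B :=
  acl_eq_dcl_of_forall_exists_ssubset fun _ => h.exists_ssubset_definable₁ hM hAB

theorem RVMeetsDefinable.meetsDefinable_dcl (hM : IsExpansion φ O)
    (h : RVMeetsDefinable L O B A) (hAB : A ⊆ B) (hprep : HasUniformPreparation L O) :
    L.MeetsDefinable (dcl L B) := by
  rintro D ⟨x, hx⟩ hD
  replace hD : B.Definable₁ L D := definable_of_dcl hD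
  obtain ⟨m, C, hCfin, hC, hCD⟩ :=
    hprep 1 B (fun _ => D) (definable_mem hD (.proj L)) fun _ _ _ => rfl
  rcases C.eq_empty_or_nonempty with rfl | hCne
  · obtain ⟨-, -, a, ha, -⟩ := h 1 D hD ⟨x, hx⟩
    exact ⟨a, (hCD 0 x a (by simp)).1 hx, subset_dcl (hAB ha)⟩
  obtain ⟨c, hc, hmin⟩ := exists_min_image C (fun c => O.valuation (x - c)) hCfin hCne
  have c_definable {V : Type} : B.DefinableFun L fun _ : V → N => c :=
    definableFun_const_of_mem_dcl (h.acl_eq_dcl hM hAB ▸ ⟨C, hCfin, hC, hc⟩)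
  have near_c_definable :
      B.Definable₁ L {z | c + z ∈ D ∧ ∀ c' ∈ C, O.valuation z ≤ O.valuation (c + z - c')} :=
    definable_and (definable_mem hD (hM.definableFun_add c_definable (.proj L)))
      (definable_forall_mem hC (hM.definable_valuation_le (.proj L)
        (hM.definableFun_sub (hM.definableFun_add c_definable (.proj L)) (.proj L))))
  obtain ⟨z, ⟨hz, hzC⟩, a, ha, hza⟩ :=
    h m _ near_c_definable ⟨x - c, by simpa using hx, by simpa using hmin⟩
  exact ⟨c + a, (hCD 0).add_mem hz hzC hza, mem_dcl_of_definableFun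
    (hM.definableFun_add c_definable (definableFun_const_of_mem_dcl (subset_dcl (hAB ha))))⟩

end Closure

section Residue

variable {M : Type w} [Field M] {O : ValuationSubring M}

theorem valuation_natCast_eq_one_of_residue_ne_zero {n : ℕ}
    (h : (n : IsLocalRing.ResidueField O) ≠ 0) : O.valuation (n : M) = 1 := by
  rw [← map_natCast (IsLocalRing.residue O), IsLocalRing.residue_ne_zero_iff_isUnit,
    O.valuation_eq_one_iff] at h
  exact_mod_cast h

theorem isFinitelyRamified_of_residue_ne_zero {n : ℕ}
    (h : (n : IsLocalRing.ResidueField O) ≠ 0) : IsFinitelyRamified O n := by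
  refine (finite_singleton 1).subset fun γ hγ => hγ.2.antisymm ?_
  rw [← valuation_natCast_eq_one_of_residue_ne_zero h]
  exact hγ.1

theorem IsFinitelyRamified.of_charP {p : ℕ} (hp : p.Prime) [CharP (IsLocalRing.ResidueField O) p]
    (h : IsFinitelyRamified O p) {l : ℕ} (hl : l.Prime) : IsFinitelyRamified O l := by
  by_cases hres : (l : IsLocalRing.ResidueField O) = 0
  · rwa [← (Nat.prime_dvd_prime_iff_eq hp hl).1 ((CharP.cast_eq_zero_iff _ p l).1 hres)]
  · exact isFinitelyRamified_of_residue_ne_zero hres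

theorem image_valuation_subset_of_image_rv_subset {R S : Set M} {lam : Radius O}
    (h : rv lam '' S ⊆ rv lam '' R) : O.valuation '' S ⊆ O.valuation '' R := by
  rintro _ ⟨s, hs, rfl⟩
  obtain ⟨r, hr, hrs⟩ := h ⟨s, hs, rfl⟩
  exact ⟨r, hr, valuation_eq_of_rv_eq hrs⟩

theorem residue_eq_of_rv_eq {lam : Radius O} {x y : O} (h : rv lam (x : M) = rv lam (y : M)) :
    IsLocalRing.residue O x = IsLocalRing.residue O y := by
  rw [← sub_eq_zero, ← map_sub, IsLocalRing.residue_eq_zero_iff, O.valuation_lt_one_iff]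
  rcases rv_eq_rv_iff.1 h with hxy | hlt
  · simp [hxy]
  · exact hlt.trans_le (mul_le_one' lam.2.2 (O.valuation_le_one y))

theorem image_residue_subset_of_image_rv_subset {R S : Set M} {lam : Radius O}
    (h : rv lam '' S ⊆ rv lam '' R) :
    IsLocalRing.residue O '' {x : O | (x : M) ∈ S} ⊆
      IsLocalRing.residue O '' {x : O | (x : M) ∈ R} := by
  rintro _ ⟨s, hs, rfl⟩
  obtain ⟨r, hr, hrs⟩ := h ⟨(s : M), hs, rfl⟩
  have hrO : r ∈ O := by
    rw [← O.valuation_le_one_iff, valuation_eq_of_rv_eq hrs]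
    exact O.valuation_le_one s
  exact ⟨⟨r, hrO⟩, hr, residue_eq_of_rv_eq hrs⟩

theorem isImmediate_of_image_rv_eq {R S : Set M} {lam : Radius O}
    (h : rv lam '' S = rv lam '' R) : IsImmediate O R S :=
  ⟨Subset.antisymm (image_valuation_subset_of_image_rv_subset h.subset)
      (image_valuation_subset_of_image_rv_subset h.superset),
    Subset.antisymm (image_residue_subset_of_image_rv_subset h.subset)
      (image_residue_subset_of_image_rv_subset h.superset)⟩

end Residue

section Minimality

variable {L : FirstOrder.Language.{u, v}} {φ : valuedField →ᴸ L} {K : Type*} {N : Type w}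
  [Field N] [CharZero N] {O : ValuationSubring N} [L.Structure K] [L.Structure N]

theorem IsZeroHMinimal.hasPreparation (hT : IsZeroHMinimal.{u, v, w} φ (L.completeTheory K))
    [Field K] {OK : ValuationSubring K} [CharZero (IsLocalRing.ResidueField OK)]
    (hK : IsExpansion φ OK) (hN : IsExpansion φ O) (f : K ↪ₑ[L] N) : HasPreparation L O := by
  intro m' A X hX
  have ofNat_eq_one (m : ℕ+) : Radius.ofNat O m = Radius.one O :=
    Radius.ofNat_eq_one <| hK.valuation_natCast_eq_one hN f <|
      valuation_natCast_eq_one_of_residue_ne_zero (Nat.cast_ne_zero.2 m.ne_zero)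
  rw [ofNat_eq_one] at hX
  obtain ⟨C, hCfin, hC, hCX⟩ := hT N O hN ((f.theory_model_iff _).1 inferInstance) A X hX
  exact ⟨1, C, hCfin, hC, by rwa [ofNat_eq_one]⟩

theorem IsZeroHMixMinimal.hasPreparation (hT : IsZeroHMixMinimal.{u, v, w} φ (L.completeTheory K))
    (hN : IsExpansion φ O) (f : K ↪ₑ[L] N) : HasPreparation L O :=
  hT N O hN ((f.theory_model_iff _).1 inferInstance)

end Minimality

section ElementarySubstructure

variable {L : FirstOrder.Language.{u, v}} {K M : Type*} [L.Structure K] [L.Structure M]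

theorem exists_elementaryEmbedding_of_range_subset (f : K ↪ₑ[L] M) (S : L.ElementarySubstructure M)
    (h : range f ⊆ S) : ∃ g : K ↪ₑ[L] S, ∀ a, (g a : M) = f a :=
  ⟨⟨fun a => ⟨f a, h (mem_range_self a)⟩, fun _ θ x =>
    (S.subtype.map_formula θ _).symm.trans (f.map_formula θ x)⟩, fun _ => rfl⟩

end ElementarySubstructure

end HMin

theorem mainTheorem2 {L : FirstOrder.Language.{u, v}} (φ : HMin.valuedField →ᴸ L)
    {K : Type w} [Field K] [CharZero K] (OK : ValuationSubring K) [L.Structure K]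
    (hK : HMin.IsExpansion φ OK)
    (hmin :
      (CharZero (IsLocalRing.ResidueField OK) ∧
        HMin.IsZeroHMinimal.{u, v, max u v w} φ (L.completeTheory K)) ∨
      (∃ p : ℕ, p.Prime ∧ CharP (IsLocalRing.ResidueField OK) p ∧
        HMin.IsFinitelyRamified OK p ∧
        HMin.IsZeroHMixMinimal.{u, v, max u v w} φ (L.completeTheory K)))
    {M : Type w} [Field M] (OM : ValuationSubring M) [L.Structure M]
    (hM : HMin.IsExpansion φ OM) (f : K ↪ₑ[L] M)
    (α : M) (hα : HMin.IsPCL OM (Set.range f) α) :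
    ∃ S : L.Substructure M,
      (S : Set M) = HMin.acl L (Set.range f ∪ {α}) ∧
      (∃ g : K ↪ₑ[L] S, ∀ a : K, ((g a : S) : M) = f a) ∧
      HMin.rv (HMin.Radius.one OM) '' (S : Set M) =
        HMin.rv (HMin.Radius.one OM) '' Set.range f ∧
      HMin.IsImmediate OM (Set.range f) (S : Set M) ∧
      HMin.acl L (Set.range f ∪ {α}) = HMin.dcl L (Set.range f ∪ {α}) := by
  have := hK.charZero_of_elementaryEmbedding hM f
  have hram (l : ℕ) (hl : l.Prime) : HMin.IsFinitelyRamified OK l := by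
    rcases hmin with ⟨_, -⟩ | ⟨p, hp, _, hp_ram, -⟩
    · exact HMin.isFinitelyRamified_of_residue_ne_zero (Nat.cast_ne_zero.2 hl.ne_zero)
    · exact hp_ram.of_charP hp hl
  have hprep : HMin.HasUniformPreparation L OM := by
    refine .of_elementaryEmbedding hM fun N _ _ O _ hN g => ?_
    rcases hmin with ⟨_, hT⟩ | ⟨_, -, -, -, hT⟩
    · exact hT.hasPreparation hK hN (g.comp f)
    · exact hT.hasPreparation hN (g.comp f)
  have hlimit : HMin.IsLeadingTermLimit OM (Set.range f) α :=
    HMin.IsPCL.isLeadingTermLimit (A := (hK.ringHom hM f).fieldRange) hα fun l hl =>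
      hK.finite_valuation_image_range hM f (hram l hl)
  have hrv := hlimit.rvMeetsDefinable hM (HMin.meetsDefinable_range f) hprep
  have hacl := hrv.acl_eq_dcl hM Set.subset_union_left
  have hmeets := hrv.meetsDefinable_dcl hM Set.subset_union_left hprep
  have hS : (hmeets.toElementarySubstructure : Set M) = HMin.dcl L (Set.range f ∪ {α}) :=
    hmeets.closure_eq_self
  have range_subset : Set.range f ⊆ HMin.dcl L (Set.range f ∪ {α}) :=
    Set.subset_union_left.trans HMin.subset_dcl
  have image_rv := hrv.image_rv_dcl Set.subset_union_left
  rw [← hS] at range_subset image_rv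
  exact ⟨hmeets.toElementarySubstructure, hS.trans hacl.symm,
    HMin.exists_elementaryEmbedding_of_range_subset f _ range_subset, image_rv,
    HMin.isImmediate_of_image_rv_eq image_rv, hacl⟩
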